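/- Let $G$ be a finite simple graph with vertex set $V=\{1,\dots,n\}$ and adjacency matrix $A$, with distinct eigenvalues $\theta_0>\theta_1>\dots>\theta_d$ of multiplicities $m_0,\dots,m_d$. For an integer $k\ge 0$, the problem $\textsc{Poly-Inertia}_\alpha(G,k)$ is $$\mu_k(G)=\min_{p}\ \sum_{0\le j\le d,\ p(\theta_j)\ge 0} m_j ,$$ where $p$ ranges over all real polynomials of degree at most $k$ such that $(p(A))_{vv}\ge 0$ for every $v\in V$. Computations are carried out on a real random access machine: the memory consists of cells, with computed addresses, that hold natural numbers or real numbers; natural numbers can be added, subtracted (truncated at $0$) and compared, real numbers can be added, subtracted, multiplied, divided and compared, programs may use natural number constants and the real constants $0$ and $1$, and each such operation, constant and memory access takes one unit of time. **Theorem.** For every fixed integer $k\ge 0$, the problem $\textsc{Poly-Inertia}_\alpha(G,k)$ can be solved in time polynomial in $n$ after preprocessing. That is, for every $k\ge 0$ there are a program and a polynomial $T$, both depending only on $k$, such that for every $n$ and every graph $G$ on $n$ vertices the following holds. Started on the preprocessed data of $G$, namely the numbers $n$ and $d+1$, the eigenvalues $\theta_0>\dots>\theta_d$, their multiplicities $m_0,\dots,m_d$,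 and the diagonal entries $(A^i)_{vv}$ for $0\le i\le k$ and $v\in V$, the program halts after at most $T(n)$ units of time and outputs the optimal value $\mu_k(G)$ together with the coefficients $a_0,\dots,a_k$ of an optimal polynomial $p(x)=a_0+a_1x+\dots+a_kx^k$. -/

import Mathlib

open Polynomial

noncomputable section

/-! # The optimisation problem -/

namespace PolyInertia

variable {n : ℕ}

/-- The adjacency matrix `A` of `G`, as a real matrix. -/
abbrev adj (G : SimpleGraph (Fin n)) [DecidableRel G.Adj] : Matrix (Fin n) (Fin n) ℝ :=
  G.adjMatrix ℝ

/-- The set of distinct eigenvalues of `A`: the roots of its characteristic polynomial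
(all of them are real, since `A` is symmetric). -/
def eigenvalueSet (G : SimpleGraph (Fin n)) [DecidableRel G.Adj] : Finset ℝ :=
  (adj G).charpoly.roots.toFinset

/-- The multiplicity of `θ` as an eigenvalue of `A`. -/
def mult (G : SimpleGraph (Fin n)) [DecidableRel G.Adj] (θ : ℝ) : ℕ :=
  (adj G).charpoly.roots.count θ

/-- The list `θ₀ > θ₁ > ⋯ > θ_d` of the distinct eigenvalues of `A`. -/
def eigenvalueList (G : SimpleGraph (Fin n)) [DecidableRel G.Adj] : List ℝ :=
  (eigenvalueSet G).sort (fun x y => x ≥ y)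

/-- `p` is admissible: it has degree at most `k`, and `p(A)` has a nonnegative diagonal. -/
def Feasible (G : SimpleGraph (Fin n)) [DecidableRel G.Adj] (k : ℕ) (p : ℝ[X]) : Prop :=
  p.natDegree ≤ k ∧ ∀ v : Fin n, 0 ≤ (aeval (adj G) p) v v

/-- The objective: the sum of the multiplicities `m_j` over those `j` with `p(θ_j) ≥ 0`. -/
def objective (G : SimpleGraph (Fin n)) [DecidableRel G.Adj] (p : ℝ[X]) : ℕ :=
  ∑ θ ∈ (eigenvalueSet G).filter (fun θ => 0 ≤ p.eval θ), mult G θ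

/-- `p` is an optimal solution of the problem with parameters `G` and `k`. -/
def IsOptimal (G : SimpleGraph (Fin n)) [DecidableRel G.Adj] (k : ℕ) (p : ℝ[X]) : Prop :=
  Feasible G k p ∧ ∀ q : ℝ[X], Feasible G k q → objective G p ≤ objective G q

/-- The optimal value `μ_k(G)`.  The set of attained values is a nonempty set of natural numbers
(the zero polynomial is admissible), so this infimum is a minimum. -/
def mu (G : SimpleGraph (Fin n)) [DecidableRel G.Adj] (k : ℕ) : ℕ :=
  sInf {c : ℕ | ∃ p : ℝ[X], Feasible G k p ∧ objective G p = c}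

end PolyInertia

/-! # The real random access machine

Programs of a structured real RAM.  The memory consists of arrays of natural numbers and arrays of
real numbers; a simple variable is cell `0` of an array.  A program names finitely many arrays, but
cells are addressed indirectly, by computed indices.  Real numbers admit the four field operations
and exact comparison, natural numbers admit addition, truncated subtraction and comparison.  The
only real constants are `0` and `1`; there is no multiplication of natural numbers and no passage
from reals to naturals (such as rounding) apart from branching on comparisons.  Every operation,
memory access, constant and comparison costs one unit. -/

namespace RealRAM

/-- The memory: `nat a i` and `real a i` are the contents of cell `i` of array `a`. -/
structure Store where
  nat : ℕ → ℕ → ℕ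
  real : ℕ → ℕ → ℝ

/-- Expressions of type natural number. -/
inductive NExp where
  | lit (c : ℕ)
  | cell (a : ℕ) (i : NExp)
  | add (e f : NExp)
  | sub (e f : NExp)

namespace NExp

def eval (s : Store) : NExp → ℕ
  | lit c => c
  | cell a i => s.nat a (i.eval s)
  | add e f => e.eval s + f.eval s
  | sub e f => e.eval s - f.eval s

def cost : NExp → ℕ
  | lit _ => 1
  | cell _ i => i.cost + 1
  | add e f => e.cost + f.cost + 1
  | sub e f => e.cost + f.cost + 1

end NExp

/-- Expressions of type real number (with the convention `x / 0 = 0`). -/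
inductive RExp where
  | zero
  | one
  | cell (a : ℕ) (i : NExp)
  | add (e f : RExp)
  | sub (e f : RExp)
  | mul (e f : RExp)
  | div (e f : RExp)

namespace RExp

def eval (s : Store) : RExp → ℝ
  | zero => 0
  | one => 1
  | cell a i => s.real a (i.eval s)
  | add e f => e.eval s + f.eval s
  | sub e f => e.eval s - f.eval s
  | mul e f => e.eval s * f.eval s
  | div e f => e.eval s / f.eval s

def cost : RExp → ℕ
  | zero => 1
  | one => 1
  | cell _ i => i.cost + 1
  | add e f => e.cost + f.cost + 1
  | sub e f => e.cost + f.cost + 1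
  | mul e f => e.cost + f.cost + 1
  | div e f => e.cost + f.cost + 1

end RExp

/-- Tests. -/
inductive Test where
  | nle (e f : NExp)
  | rle (e f : RExp)
  | neg (b : Test)
  | conj (b c : Test)

namespace Test

def Holds (s : Store) : Test → Prop
  | nle e f => e.eval s ≤ f.eval s
  | rle e f => e.eval s ≤ f.eval s
  | neg b => ¬ b.Holds s
  | conj b c => b.Holds s ∧ c.Holds s

def cost : Test → ℕ
  | nle e f => e.cost + f.cost + 1
  | rle e f => e.cost + f.cost + 1
  | neg b => b.cost + 1
  | conj b c => b.cost + c.cost + 1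

end Test

/-- Programs: `setNat a i e` and `setReal a i e` write the value of `e` into cell `i` of array `a`;
`ite` is a branch and `loop b P` repeats `P` as long as `b` holds. -/
inductive Prog where
  | skip
  | setNat (a : ℕ) (i e : NExp)
  | setReal (a : ℕ) (i : NExp) (e : RExp)
  | seq (P Q : Prog)
  | ite (b : Test) (P Q : Prog)
  | loop (b : Test) (P : Prog)

namespace Store

def setNat (s : Store) (a i c : ℕ) : Store where
  nat := Function.update s.nat a (Function.update (s.nat a) i c)
  real := s.real

def setReal (s : Store) (a i : ℕ) (x : ℝ) : Store where
  nat := s.nat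
  real := Function.update s.real a (Function.update (s.real a) i x)

end Store

/-- `Exec P s t s'`: started on the memory `s`, the program `P` halts after `t` units of time with
memory `s'`. -/
inductive Exec : Prog → Store → ℕ → Store → Prop where
  | skip (s : Store) : Exec Prog.skip s 1 s
  | setNat (a : ℕ) (i e : NExp) (s : Store) :
      Exec (Prog.setNat a i e) s (i.cost + e.cost + 1) (s.setNat a (i.eval s) (e.eval s))
  | setReal (a : ℕ) (i : NExp) (e : RExp) (s : Store) :
      Exec (Prog.setReal a i e) s (i.cost + e.cost + 1) (s.setReal a (i.eval s) (e.eval s))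
  | seq {P Q : Prog} {s s₁ s₂ : Store} {t₁ t₂ : ℕ} :
      Exec P s t₁ s₁ → Exec Q s₁ t₂ s₂ → Exec (Prog.seq P Q) s (t₁ + t₂) s₂
  | iteTrue {b : Test} {P Q : Prog} {s s₁ : Store} {t : ℕ} :
      b.Holds s → Exec P s t s₁ → Exec (Prog.ite b P Q) s (b.cost + 1 + t) s₁
  | iteFalse {b : Test} {P Q : Prog} {s s₁ : Store} {t : ℕ} :
      ¬ b.Holds s → Exec Q s t s₁ → Exec (Prog.ite b P Q) s (b.cost + 1 + t) s₁
  | loopDone {b : Test} {P : Prog} {s : Store} :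
      ¬ b.Holds s → Exec (Prog.loop b P) s (b.cost + 1) s
  | loopStep {b : Test} {P : Prog} {s s₁ s₂ : Store} {t₁ t₂ : ℕ} :
      b.Holds s → Exec P s t₁ s₁ → Exec (Prog.loop b P) s₁ t₂ s₂ →
      Exec (Prog.loop b P) s (b.cost + 1 + t₁ + t₂) s₂

/-- The machine is deterministic: the running time and the final memory are unique. -/
theorem Exec.unique {P : Prog} {s s₁ s₂ : Store} {t₁ t₂ : ℕ}
    (h₁ : Exec P s t₁ s₁) (h₂ : Exec P s t₂ s₂) : t₁ = t₂ ∧ s₁ = s₂ := by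
  induction h₁ generalizing t₂ s₂ with
  | skip s => cases h₂; exact ⟨rfl, rfl⟩
  | setNat a i e s => cases h₂; exact ⟨rfl, rfl⟩
  | setReal a i e s => cases h₂; exact ⟨rfl, rfl⟩
  | seq _ _ ih₁ ih₂ =>
    cases h₂ with
    | seq g₁ g₂ =>
      obtain ⟨rfl, rfl⟩ := ih₁ g₁
      obtain ⟨rfl, rfl⟩ := ih₂ g₂
      exact ⟨rfl, rfl⟩
  | iteTrue hb _ ih =>
    cases h₂ with
    | iteTrue _ g => obtain ⟨rfl, rfl⟩ := ih g; exact ⟨rfl, rfl⟩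
    | iteFalse hn _ => exact absurd hb hn
  | iteFalse hb _ ih =>
    cases h₂ with
    | iteTrue hn _ => exact absurd hn hb
    | iteFalse _ g => obtain ⟨rfl, rfl⟩ := ih g; exact ⟨rfl, rfl⟩
  | loopDone hb =>
    cases h₂ with
    | loopDone _ => exact ⟨rfl, rfl⟩
    | loopStep hn _ _ => exact absurd hn hb
  | loopStep hb _ _ ih₁ ih₂ =>
    cases h₂ with
    | loopDone hn => exact absurd hb hn
    | loopStep _ g₁ g₂ =>
      obtain ⟨rfl, rfl⟩ := ih₁ g₁
      obtain ⟨rfl, rfl⟩ := ih₂ g₂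
      exact ⟨rfl, rfl⟩

end RealRAM

/-! # The preprocessed instance -/

namespace PolyInertia

/-- The initial memory, holding exactly the result of the preprocessing of `G` for degree `k`:
* array `0` of naturals: the number `n` of vertices (cell `0`) and the number `d + 1` of distinct
  eigenvalues (cell `1`);
* array `1` of naturals: the multiplicities `m₀, …, m_d`;
* array `0` of reals: the distinct eigenvalues `θ₀ > ⋯ > θ_d`;
* array `i + 1` of reals, for `i = 0, …, k`: the diagonal entries `(A ^ i)_{vv}`.

All other cells are zero. -/
def preprocessed {n : ℕ} (G : SimpleGraph (Fin n)) [DecidableRel G.Adj] (k : ℕ) :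
    RealRAM.Store where
  nat a j :=
    match a with
    | 0 => if j = 0 then n else if j = 1 then (eigenvalueList G).length else 0
    | 1 => ((eigenvalueList G).map (mult G)).getD j 0
    | _ => 0
  real a j :=
    match a with
    | 0 => (eigenvalueList G).getD j 0
    | i + 1 => if h : i ≤ k ∧ j < n then (adj G ^ i) ⟨j, h.2⟩ ⟨j, h.2⟩ else 0

end PolyInertia

end

/-! Identify `p` with its coefficient vector in `ℝ^(k+1)`. Each diagonal entry of `p(A)` and each
value `p(θ_j)` is a linear form in that vector, so admissibility is a system of linear inequalities
and the objective depends only on which of the forms `p(θ_j)` are negative.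

Take any admissible `q` and multiply it by a large positive scalar, so that its negative values at
eigenvalues are at most `-1`. It then lies in the polyhedron given by the diagonal inequalities, by
`p(θ_j) ≤ -1` wherever `q(θ_j) < 0`, and by sign conditions on the coefficients that copy the signs
of `q`. The sign conditions exclude lines, so the polyhedron has a vertex. The vertex is admissible
and negative wherever `q` is, hence no worse than `q`; being a vertex, it solves `k + 1` independent
equations taken from a list of `n + (d+1) + (k+1)` equations that does not depend on `q`
(`IsTable.exists_basicSolution`).

It therefore suffices to run over all `(k+1)`-tuples of equations, solve each system by Cramer's
rule, and keep the best admissible solution. For fixed `k` the number of tuples is polynomial in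
`n`, and determinants of order `k + 1` are expressions of constant size (`Expressible.det`). The
search starts from the zero polynomial. -/

namespace RealRAM

/-- `Runs P s T Q`: started on `s`, the program `P` halts within `T` units of time on a memory
satisfying `Q`. -/
def Runs (P : Prog) (s : Store) (T : ℕ) (Q : Store → Prop) : Prop :=
  ∃ t s', Exec P s t s' ∧ t ≤ T ∧ Q s'

/-! ### Composition of time bounds and the effect of memory writes -/

section Runs

variable {P P' : Prog} {s : Store} {T T₁ T₂ : ℕ} {Q R : Store → Prop}

theorem Runs.mono (h : Runs P s T₁ Q) (hT : T₁ ≤ T₂) (hQ : ∀ s', Q s' → R s') :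
    Runs P s T₂ R := by
  obtain ⟨t, s', he, ht, hq⟩ := h
  exact ⟨t, s', he, ht.trans hT, hQ _ hq⟩

theorem Runs.seq (h : Runs P s T₁ fun s' => Runs P' s' T₂ R) : Runs (P.seq P') s (T₁ + T₂) R := by
  obtain ⟨t, s', he, ht, t', s'', he', ht', hr⟩ := h
  exact ⟨t + t', s'', he.seq he', by omega, hr⟩

theorem Runs.skip (h : Q s) : Runs .skip s 1 Q :=
  ⟨1, s, .skip s, le_rfl, h⟩

theorem Runs.setNat {a : ℕ} {i e : NExp} (h : Q (s.setNat a (i.eval s) (e.eval s))) :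
    Runs (.setNat a i e) s (i.cost + e.cost + 1) Q :=
  ⟨_, _, .setNat a i e s, le_rfl, h⟩

theorem Runs.setReal {a : ℕ} {i : NExp} {e : RExp}
    (h : Q (s.setReal a (i.eval s) (e.eval s))) :
    Runs (.setReal a i e) s (i.cost + e.cost + 1) Q :=
  ⟨_, _, .setReal a i e s, le_rfl, h⟩

theorem Runs.ite {b : Test} (h₁ : b.Holds s → Runs P s T₁ Q) (h₂ : ¬ b.Holds s → Runs P' s T₂ Q) :
    Runs (.ite b P P') s (b.cost + 1 + (T₁ + T₂)) Q := by
  by_cases hb : b.Holds s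
  · obtain ⟨t, s', he, ht, hq⟩ := h₁ hb
    exact ⟨_, s', .iteTrue hb he, by omega, hq⟩
  · obtain ⟨t, s', he, ht, hq⟩ := h₂ hb
    exact ⟨_, s', .iteFalse hb he, by omega, hq⟩

end Runs

@[simp] theorem Store.setNat_real (s : Store) (a i c : ℕ) : (s.setNat a i c).real = s.real := rfl

theorem Store.setNat_nat (s : Store) (a i c b j : ℕ) :
    (s.setNat a i c).nat b j = if b = a ∧ j = i then c else s.nat b j := by
  unfold Store.setNat
  by_cases hb : b = a
  · subst hb; by_cases hj : j = i <;> simp [hj]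
  · simp [hb]

theorem Store.setReal_real (s : Store) (a i : ℕ) (x : ℝ) (b j : ℕ) :
    (s.setReal a i x).real b j = if b = a ∧ j = i then x else s.real b j := by
  unfold Store.setReal
  by_cases hb : b = a
  · subst hb; by_cases hj : j = i <;> simp [hj]
  · simp [hb]

theorem Store.setNat_nat_of_ne (s : Store) {a b : ℕ} (i c : ℕ) (h : b ≠ a) :
    (s.setNat a i c).nat b = s.nat b := by
  funext j; simp [Store.setNat_nat, h]

theorem NExp.eval_congr {s s' : Store} (h : s'.nat = s.nat) (e : NExp) : e.eval s' = e.eval s := by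
  induction e <;> simp_all [NExp.eval]

/-! ### Functions computed by a single expression, hence in constant time -/

/-- `Expressible F`: the function `F` of the memory is the value of a real expression. -/
def Expressible (F : Store → ℝ) : Prop := ∃ e : RExp, ∀ s, e.eval s = F s

namespace Expressible

variable {F F' : Store → ℝ}

theorem zero : Expressible fun _ => 0 := ⟨.zero, fun _ => rfl⟩

theorem one : Expressible fun _ => 1 := ⟨.one, fun _ => rfl⟩

theorem cell (a : ℕ) (i : NExp) : Expressible fun s => s.real a (i.eval s) :=
  ⟨.cell a i, fun _ => rfl⟩

theorem add (h : Expressible F) (h' : Expressible F') : Expressible fun s => F s + F' s := by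
  obtain ⟨e, he⟩ := h; obtain ⟨e', he'⟩ := h'
  exact ⟨.add e e', fun s => by simp [RExp.eval, he, he']⟩

theorem sub (h : Expressible F) (h' : Expressible F') : Expressible fun s => F s - F' s := by
  obtain ⟨e, he⟩ := h; obtain ⟨e', he'⟩ := h'
  exact ⟨.sub e e', fun s => by simp [RExp.eval, he, he']⟩

theorem neg (h : Expressible F) : Expressible fun s => - F s := by
  simpa using zero.sub h

theorem mul (h : Expressible F) (h' : Expressible F') : Expressible fun s => F s * F' s := by
  obtain ⟨e, he⟩ := h; obtain ⟨e', he'⟩ := h'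
  exact ⟨.mul e e', fun s => by simp [RExp.eval, he, he']⟩

theorem div (h : Expressible F) (h' : Expressible F') : Expressible fun s => F s / F' s := by
  obtain ⟨e, he⟩ := h; obtain ⟨e', he'⟩ := h'
  exact ⟨.div e e', fun s => by simp [RExp.eval, he, he']⟩

theorem pow (h : Expressible F) (m : ℕ) : Expressible fun s => F s ^ m := by
  induction m with
  | zero => simpa using one
  | succ m ih => simpa only [pow_succ] using ih.mul h

theorem sum {ι : Type*} (S : Finset ι) {F : ι → Store → ℝ} (h : ∀ i, Expressible (F i)) :
    Expressible fun s => ∑ i ∈ S, F i s := by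
  classical
  induction S using Finset.induction_on with
  | empty => simpa using zero
  | insert i S hi ih => simpa only [Finset.sum_insert hi] using (h i).add ih

theorem prod {ι : Type*} (S : Finset ι) {F : ι → Store → ℝ} (h : ∀ i, Expressible (F i)) :
    Expressible fun s => ∏ i ∈ S, F i s := by
  classical
  induction S using Finset.induction_on with
  | empty => simpa using one
  | insert i S hi ih => simpa only [Finset.prod_insert hi] using (h i).mul ih

/-- The Leibniz formula is itself an expression without division or branching, the same one for
every memory, so its cost depends on the index type alone. -/
theorem det {ι : Type*} [Fintype ι] [DecidableEq ι] {F : Store → Matrix ι ι ℝ}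
    (h : ∀ i j, Expressible fun s => F s i j) : Expressible fun s => (F s).det := by
  simp only [Matrix.det_apply']
  refine sum _ fun σ => mul ?_ (prod _ fun i => h _ _)
  rcases Int.units_eq_one_or (Equiv.Perm.sign σ) with hσ | hσ
  · simpa [hσ] using one
  · simpa [hσ] using one.neg

end Expressible

/-! ### Loops and their running times -/

namespace Prog

/-- `forLoop a c e P` runs `P` with cell `c` of the array `a` counting from `0` up to the value
of `e`. -/
def forLoop (a c : ℕ) (e : NExp) (P : Prog) : Prog :=
  seq (setNat a (.lit c) (.lit 0))
    (loop (.neg (.nle e (.cell a (.lit c))))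
      (seq P (setNat a (.lit c) (.add (.cell a (.lit c)) (.lit 1)))))

/-- `nest a e P c` runs `P` for all values below the value of `e` of the cells `0, …, c - 1` of the
array `a`. -/
def nest (a : ℕ) (e : NExp) (P : Prog) : ℕ → Prog
  | 0 => P
  | c + 1 => forLoop a c e (nest a e P c)

/-- `rep P m` runs the programs `P 0, …, P (m - 1)`. -/
def rep (P : ℕ → Prog) : ℕ → Prog
  | 0 => skip
  | c + 1 => seq (rep P c) (P c)

/-- `sumLoop a b e t w` writes to cell `0` of the array `b` the sum of the values of `w` under the
condition `t`, where cell `0` of the array `a` counts from `0` up to the value of `e`. -/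
def sumLoop (a b : ℕ) (e : NExp) (t : Test) (w : NExp) : Prog :=
  seq (setNat b (.lit 0) (.lit 0))
    (forLoop a 0 e (ite t (setNat b (.lit 0) (.add (.cell b (.lit 0)) w)) skip))

end Prog

/-- The invariant fixes both the counter and the value of the bound, and `step` asks for it after
the counter has been incremented. The constant `15` generously covers the test, the increment and
the initialisation. -/
theorem Runs.forLoop {a c : ℕ} {e : NExp} {P : Prog} {s : Store} {N T : ℕ}
    (I : ℕ → Store → Prop) (h0 : I 0 (s.setNat a c 0))
    (hN : ∀ i s', I i s' → e.eval s' = N) (hi : ∀ i s', I i s' → s'.nat a c = i)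
    (step : ∀ i < N, ∀ s', I i s' →
      Runs P s' T fun s'' => I (i + 1) (s''.setNat a c (s''.nat a c + 1))) :
    Runs (.forLoop a c e P) s ((N + 1) * (T + e.cost + 15)) (I N) := by
  have key : ∀ r i s', i + r = N → I i s' →
      Runs (.loop (.neg (.nle e (.cell a (.lit c))))
        (.seq P (.setNat a (.lit c) (.add (.cell a (.lit c)) (.lit 1))))) s'
        (r * (T + e.cost + 15) + e.cost + 5) (I N) := by
    intro r
    induction r with
    | zero =>
      intro i s' hr hI
      obtain rfl : i = N := by omega
      refine ⟨_, s', .loopDone ?_, ?_, hI⟩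
      · simp [Test.Holds, NExp.eval, hN _ _ hI, hi _ _ hI]
      · simp [Test.cost, NExp.cost]
    | succ r ih =>
      intro i s' hr hI
      obtain ⟨t, s₁, he, ht, h1⟩ := step i (by omega) s' hI
      obtain ⟨t', s₂, he', ht', h2⟩ := ih (i + 1) _ (by omega) h1
      refine ⟨_, s₂, .loopStep ?_ (.seq he (.setNat _ _ _ _)) he', ?_, h2⟩
      · simp [Test.Holds, NExp.eval, hN _ _ hI, hi _ _ hI]; omega
      · simp only [Test.cost, NExp.cost]
        have : (r + 1) * (T + e.cost + 15) = r * (T + e.cost + 15) + (T + e.cost + 15) := by ring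
        omega
  refine (Runs.seq (Runs.setNat (key N 0 _ (by omega) h0))).mono ?_ fun _ h => h
  have : (N + 1) * (T + e.cost + 15) = N * (T + e.cost + 15) + (T + e.cost + 15) := by ring
  simp only [NExp.cost]
  omega

/-- Tool for minimising over tuples: `V` is the best value so far, which never increases, and `good
σ v` says that `v` is at least as good as what the tuple `σ` offers. Goodness survives a decrease of
`v`, so what the body establishes for each tuple in turn holds for all of them at the end. -/
theorem Runs.nest {a : ℕ} {e : NExp} {P : Prog} {N T : ℕ} (I : Store → Prop) (V : Store → ℕ)
    (good : (ℕ → ℕ) → ℕ → Prop) (hgood : ∀ σ v v', v' ≤ v → good σ v → good σ v')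
    (hI : ∀ s c x, I s → I (s.setNat a c x)) (hV : ∀ s c x, V (s.setNat a c x) = V s)
    (hN : ∀ s, I s → e.eval s = N)
    (hP : ∀ s, I s → Runs P s T fun s' =>
      I s' ∧ s'.nat a = s.nat a ∧ V s' ≤ V s ∧ good (s.nat a) (V s')) (c : ℕ) (s : Store)
    (hs : I s) :
    Runs (.nest a e P c) s ((N + 1) ^ c * (T + c * (e.cost + 15))) fun s' =>
      I s' ∧ (∀ j, c ≤ j → s'.nat a j = s.nat a j) ∧ V s' ≤ V s ∧
        ∀ σ : ℕ → ℕ, (∀ j < c, σ j < N) → (∀ j, c ≤ j → σ j = s.nat a j) → good σ (V s') := by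
  induction c generalizing s with
  | zero =>
    refine (hP s hs).mono (by simp) fun s' ⟨h1, h2, h3, h4⟩ => ⟨h1, by simp [h2], h3, ?_⟩
    intro σ _ hσ
    rwa [show σ = s.nat a from funext fun j => hσ j (Nat.zero_le j)]
  | succ c ih =>
    refine (Runs.forLoop (N := N) (fun i s' => I s' ∧ s'.nat a c = i ∧
      (∀ j, c + 1 ≤ j → s'.nat a j = s.nat a j) ∧ V s' ≤ V s ∧
      ∀ σ : ℕ → ℕ, (∀ j < c, σ j < N) → σ c < i → (∀ j, c + 1 ≤ j → σ j = s.nat a j) →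
        good σ (V s')) ?_ (fun i s' h => hN s' h.1) (fun i s' h => h.2.1)
        (T := (N + 1) ^ c * (T + c * (e.cost + 15))) ?_).mono ?_ ?_
    · refine ⟨hI _ _ _ hs, by simp [Store.setNat_nat], fun j hj => ?_, (hV _ _ _).le, ?_⟩
      · rw [Store.setNat_nat, if_neg (by omega)]
      · intro σ _ h; omega
    · rintro i hiN s₁ ⟨h1, h2, h3, h4, h5⟩
      refine (ih s₁ h1).mono le_rfl ?_
      rintro s₂ ⟨g1, g2, g3, g4⟩
      refine ⟨hI _ _ _ g1, ?_, fun j hj => ?_, ?_, ?_⟩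
      · simp [Store.setNat_nat, g2 c le_rfl, h2]
      · rw [Store.setNat_nat, if_neg (by omega), g2 j (by omega), h3 j hj]
      · rw [hV]; exact g3.trans h4
      · intro σ hσ hσc hσj
        rw [hV]
        -- Either `σ` was treated in an earlier round and stays good as `V` decreases, or its
        -- coordinate `c` is the current counter value and the inner loops have just treated it.
        rcases Nat.lt_succ_iff_lt_or_eq.mp hσc with h | h
        · exact hgood _ _ _ g3 (h5 σ hσ h hσj)
        · refine g4 σ hσ fun j hj => ?_
          rcases hj.eq_or_lt with rfl | hj
          · rw [h, h2]
          · rw [hσj j hj, h3 j hj]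
    -- The overhead of one round is charged to each of the at least one inner tuples, which makes
    -- the bound close up under induction.
    · have h1 : 1 ≤ (N + 1) ^ c := Nat.one_le_pow _ _ (by omega)
      calc (N + 1) * ((N + 1) ^ c * (T + c * (e.cost + 15)) + e.cost + 15)
          = (N + 1) * ((N + 1) ^ c * (T + c * (e.cost + 15)) + 1 * (e.cost + 15)) := by ring
        _ ≤ (N + 1) * ((N + 1) ^ c * (T + c * (e.cost + 15)) + (N + 1) ^ c * (e.cost + 15)) := by
          gcongr
        _ = _ := by ring
    · rintro s' ⟨h1, h2, h3, h4, h5⟩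
      exact ⟨h1, h3, h4, fun σ hσ hσj =>
        h5 σ (fun j hj => hσ j (by omega)) (hσ c (by omega)) hσj⟩

/-- Consecutive writes act like one simultaneous assignment, because the target cells are distinct
and `hx` makes the assigned values insensitive to the contents of those cells. -/
theorem Runs.rep_setReal (a : ℕ → ℕ) (i : ℕ → NExp) (e : ℕ → RExp) (x : ℕ → ℝ) (D : ℕ) (s : Store)
    (hinj : ∀ c < D, ∀ c' < c, a c' = a c → (i c').eval s ≠ (i c).eval s)
    (hx : ∀ s', s'.nat = s.nat →
      (∀ b j, (∀ c < D, a c = b → (i c).eval s ≠ j) → s'.real b j = s.real b j) →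
      ∀ c < D, (e c).eval s' = x c) :
    Runs (.rep (fun c => .setReal (a c) (i c) (e c)) D) s
      (∑ c ∈ Finset.range D, ((i c).cost + (e c).cost + 1) + 1) fun s' =>
      s'.nat = s.nat ∧
      (∀ b j, (∀ c < D, a c = b → (i c).eval s ≠ j) → s'.real b j = s.real b j) ∧
      ∀ c < D, s'.real (a c) ((i c).eval s) = x c := by
  suffices ∀ d ≤ D, Runs (.rep (fun c => .setReal (a c) (i c) (e c)) d) s
      (∑ c ∈ Finset.range d, ((i c).cost + (e c).cost + 1) + 1) fun s' =>
      s'.nat = s.nat ∧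
      (∀ b j, (∀ c < d, a c = b → (i c).eval s ≠ j) → s'.real b j = s.real b j) ∧
      ∀ c < d, s'.real (a c) ((i c).eval s) = x c from this D le_rfl
  intro d
  induction d with
  | zero => exact fun _ => (Runs.skip (by simp)).mono (by simp) fun _ h => h
  | succ d ih =>
    intro hd
    refine (Runs.seq ((ih (by omega)).mono le_rfl ?_)).mono (T₁ := _ + ((i d).cost + (e d).cost + 1))
      (by rw [Finset.sum_range_succ]; omega) fun _ h => h
    rintro s' ⟨h1, h2, h3⟩
    refine Runs.setReal ⟨h1, fun b j hb => ?_, fun c hc => ?_⟩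
    · rw [Store.setReal_real, if_neg]
      · exact h2 b j fun c hc => hb c (by omega)
      · rintro ⟨rfl, rfl⟩
        exact hb d (by omega) rfl (NExp.eval_congr h1 _).symm
    · rw [Store.setReal_real, NExp.eval_congr h1]
      rcases Nat.lt_succ_iff_lt_or_eq.mp hc with h | rfl
      · rw [if_neg fun hh => hinj d hd c h hh.1 hh.2, h3 c h]
      · rw [if_pos ⟨rfl, rfl⟩]
        exact hx s' h1 (fun b j hb => h2 b j fun c hc => hb c (by omega)) c hd

open Classical in
theorem Runs.sumLoop {a b : ℕ} (hab : a ≠ b) {e : NExp} {t : Test} {w : NExp} (s : Store)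
    {N : ℕ} (p : ℕ → Prop) (x : ℕ → ℕ)
    (h : ∀ s', s'.real = s.real → (∀ c, c ≠ a → c ≠ b → s'.nat c = s.nat c) →
      e.eval s' = N ∧ (s'.nat a 0 < N → (t.Holds s' ↔ p (s'.nat a 0)) ∧
        w.eval s' = x (s'.nat a 0))) :
    Runs (.sumLoop a b e t w) s ((N + 1) * (t.cost + w.cost + e.cost + 30)) fun s' =>
      s'.real = s.real ∧ (∀ c, c ≠ a → c ≠ b → s'.nat c = s.nat c) ∧
        s'.nat b 0 = ∑ i ∈ Finset.range N, if p i then x i else 0 := by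
  refine (Runs.seq (Runs.setNat (Runs.forLoop (N := N) (T := t.cost + w.cost + 10)
    (fun i s' => (s'.real = s.real ∧ (∀ c, c ≠ a → c ≠ b → s'.nat c = s.nat c)) ∧
      s'.nat b 0 = (∑ i ∈ Finset.range i, if p i then x i else 0) ∧ s'.nat a 0 = i)
    ?_ (fun i s' hs => (h s' hs.1.1 hs.1.2).1) (fun i s' hs => hs.2.2) ?_))).mono ?_ ?_
  · refine ⟨⟨rfl, fun c ha hb => ?_⟩, ?_, ?_⟩
    · rw [Store.setNat_nat_of_ne _ _ _ ha, Store.setNat_nat_of_ne _ _ _ hb]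
    · simp [Store.setNat_nat, NExp.eval, hab.symm]
    · simp [Store.setNat_nat]
  · rintro i hi s' ⟨⟨h1, h2⟩, h3, h4⟩
    have h5 := (h s' h1 h2).2 (by omega)
    rw [h4] at h5
    refine (Runs.ite (T₁ := w.cost + 6) (T₂ := 1) (fun ht => ?_) fun ht => ?_).mono (by omega)
      fun _ h => h
    · refine (Runs.setNat ⟨⟨h1, fun c ha hb => ?_⟩, ?_, ?_⟩).mono (by simp [NExp.cost]; omega)
        fun _ h => h
      · rw [Store.setNat_nat_of_ne _ _ _ ha, Store.setNat_nat_of_ne _ _ _ hb, h2 c ha hb]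
      · rw [Store.setNat_nat, if_neg (by simp [hab.symm]), Finset.sum_range_succ,
          if_pos (h5.1.mp ht)]
        simp [Store.setNat_nat, NExp.eval, h3, h5.2]
      · simp [Store.setNat_nat, hab, h4]
    · refine Runs.skip ⟨⟨h1, fun c ha hb => ?_⟩, ?_, ?_⟩
      · rw [Store.setNat_nat_of_ne _ _ _ ha, h2 c ha hb]
      · rw [Store.setNat_nat, if_neg (by simp [hab.symm]), Finset.sum_range_succ,
          if_neg (fun hp => ht (h5.1.mpr hp)), h3, add_zero]
      · simp [Store.setNat_nat, h4]
  · simp only [NExp.cost]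
    have : (N + 1) * (t.cost + w.cost + e.cost + 30) =
      (N + 1) * (t.cost + w.cost + 10 + e.cost + 15) + (N + 1) * 5 := by ring
    omega
  · exact fun s' hs => ⟨hs.1.1, hs.1.2, hs.2.1⟩

end RealRAM

/-! ### Vertices of polyhedra and Cramer's rule -/

/-- Existence of a vertex: at a feasible point with the most active constraints, a nonzero direction
killed by all active forms would allow a move, keeping these active, until a further constraint
becomes active. -/
theorem exists_spanning_active_constraints {ι : Type*} [Finite ι] {D : ℕ} (f : ι → Fin D → ℝ)
    (b : ι → ℝ) (hspan : ∀ y, (∀ i, f i ⬝ᵥ y = 0) → y = 0) (x₀ : Fin D → ℝ)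
    (hx₀ : ∀ i, b i ≤ f i ⬝ᵥ x₀) :
    ∃ x, (∀ i, b i ≤ f i ⬝ᵥ x) ∧ ∀ y, (∀ i, f i ⬝ᵥ x = b i → f i ⬝ᵥ y = 0) → y = 0 := by
  classical
  cases nonempty_fintype ι
  let act : (Fin D → ℝ) → Finset ι := fun x => Finset.univ.filter fun i => f i ⬝ᵥ x = b i
  obtain ⟨N, ⟨x, hx, rfl⟩, hmax⟩ : ∃ N, (∃ x, (∀ i, b i ≤ f i ⬝ᵥ x) ∧ (act x).card = N) ∧
      ∀ x', (∀ i, b i ≤ f i ⬝ᵥ x') → (act x').card ≤ N := by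
    -- The maximum is obtained by minimising the number `m` of inactive constraints.
    have hne : ∃ m, ∃ x, (∀ i, b i ≤ f i ⬝ᵥ x) ∧ (act x).card + m = Fintype.card ι :=
      ⟨_, x₀, hx₀, Nat.add_sub_of_le (Finset.card_le_univ _)⟩
    obtain ⟨x, hx, hc⟩ := Nat.find_spec hne
    refine ⟨_, ⟨x, hx, rfl⟩, fun x' hx' => ?_⟩
    have h1 := Nat.find_min' hne ⟨x', hx', Nat.add_sub_of_le (Finset.card_le_univ _)⟩
    have h2 := Finset.card_le_univ (act x')
    omega
  refine ⟨x, hx, fun y hy => ?_⟩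
  by_contra hy0
  -- One of `y` and `-y` strictly decreases some form, so the move along it is eventually stopped.
  obtain ⟨z, hz, hneg⟩ : ∃ z, (∀ i, f i ⬝ᵥ x = b i → f i ⬝ᵥ z = 0) ∧ ∃ i, f i ⬝ᵥ z < 0 := by
    obtain ⟨i, hi⟩ : ∃ i, f i ⬝ᵥ y ≠ 0 := by
      by_contra! h
      exact hy0 (hspan y h)
    rcases lt_or_gt_of_ne hi with h | h
    · exact ⟨y, hy, i, h⟩
    · exact ⟨-y, fun i h => by simp [hy i h], i, by simpa using h⟩
  let S := Finset.univ.filter fun i => f i ⬝ᵥ z < 0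
  obtain ⟨i₀, hi₀, hmin⟩ := S.exists_min_image (fun i => (f i ⬝ᵥ x - b i) / (-(f i ⬝ᵥ z)))
    (by obtain ⟨i, hi⟩ := hneg; exact ⟨i, by simpa [S] using hi⟩)
  have hi₀' : f i₀ ⬝ᵥ z < 0 := by simpa [S] using hi₀
  -- The largest step that remains feasible; it makes `i₀`, which was inactive, active.
  set t := (f i₀ ⬝ᵥ x - b i₀) / (-(f i₀ ⬝ᵥ z)) with ht
  have ht0 : 0 ≤ t := div_nonneg (by linarith [hx i₀]) (by linarith)
  have heval : ∀ i, f i ⬝ᵥ (x + t • z) = f i ⬝ᵥ x + t * (f i ⬝ᵥ z) := fun i => by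
    simp [dotProduct_add, dotProduct_smul]
  have hfeas : ∀ i, b i ≤ f i ⬝ᵥ (x + t • z) := by
    intro i
    rw [heval]
    rcases lt_or_ge (f i ⬝ᵥ z) 0 with h | h
    · have := hmin i (by simpa [S] using h)
      rw [le_div_iff₀ (by linarith)] at this
      linarith
    · have := hx i
      have := mul_nonneg ht0 h
      linarith
  have hlt : (act x).card < (act (x + t • z)).card := by
    refine Finset.card_lt_card (Finset.ssubset_iff_of_subset ?_ |>.mpr ⟨i₀, ?_, ?_⟩)
    · intro i hi
      simp only [act, Finset.mem_filter, Finset.mem_univ, true_and] at hi ⊢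
      rw [heval, hz i hi, hi]; ring
    · simp only [act, Finset.mem_filter, Finset.mem_univ, true_and]
      rw [heval, ht]
      field_simp [hi₀'.ne]
      ring
    · simp only [act, Finset.mem_filter, Finset.mem_univ, true_and]
      exact fun h => hi₀'.ne (hz i₀ h)
  exact absurd (hmax _ hfeas) (by omega)

/-- A functional vanishing on the span of the `f i` is the dot product with a vector that they all
annihilate, hence zero. So the `f i` span, and a basis chosen among them gives the rows of an
invertible matrix. -/
theorem exists_det_ne_zero_of_spanning {ι : Type*} {D : ℕ} (f : ι → Fin D → ℝ)
    (hspan : ∀ y, (∀ i, f i ⬝ᵥ y = 0) → y = 0) :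
    ∃ g : Fin D → ι, (Matrix.of fun c => f (g c)).det ≠ 0 := by
  have htop : Submodule.span ℝ (Set.range f) = ⊤ := by
    by_contra hne
    obtain ⟨φ, hφ, hle⟩ := Submodule.exists_le_ker_of_lt_top _ (lt_top_iff_ne_top.mpr hne)
    apply hφ
    have hφ' : ∀ v, φ v = v ⬝ᵥ fun c => φ (Pi.single c 1) := fun v => by
      conv_lhs => rw [← Finset.univ_sum_single v, map_sum]
      refine Finset.sum_congr rfl fun c _ => ?_
      rw [show (Pi.single c (v c) : Fin D → ℝ) = v c • Pi.single c 1 by simp [← Pi.single_smul],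
        map_smul, smul_eq_mul]
    have := hspan (fun c => φ (Pi.single c 1)) fun i => by
      rw [← hφ']; exact hle (Submodule.subset_span ⟨i, rfl⟩)
    ext c
    simpa using congrFun this c
  obtain ⟨κ, g, hinj, hsp, hli⟩ := exists_linearIndependent' ℝ f
  let B := Module.Basis.mk hli (by rw [hsp, htop])
  have : Finite κ := Module.Finite.finite_basis B
  cases nonempty_fintype κ
  have hcard : Fintype.card κ = D := by
    simpa using (Module.finrank_eq_card_basis B).symm
  let E : Fin D ≃ κ := (Fintype.equivFinOfCardEq hcard).symm
  refine ⟨g ∘ E, ?_⟩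
  have hli' : LinearIndependent ℝ (fun c => f (g (E c))) := hli.comp E E.injective
  have := Matrix.linearIndependent_rows_iff_isUnit (A := Matrix.of fun c => f (g (E c))) |>.mp hli'
  exact ((Matrix.isUnit_iff_isUnit_det _).mp this).ne_zero

theorem Matrix.eq_cramer_div_det {ι : Type*} [Fintype ι] [DecidableEq ι] {M : Matrix ι ι ℝ}
    {b x : ι → ℝ} (hM : M.det ≠ 0) (hx : M.mulVec x = b) (i : ι) :
    x i = (M.updateCol i b).det / M.det := by
  rw [← Matrix.cramer_apply, ← hx, Matrix.cramer_eq_adjugate_mulVec, Matrix.mulVec_mulVec,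
    Matrix.adjugate_mul, Matrix.smul_mulVec, Matrix.one_mulVec]
  simp [hM]

/-! ### Reduction to finitely many basic solutions -/

namespace PolyInertia

/-- The linear form with the coefficients `tab 0 r, …, tab k r`, evaluated at `a`. -/
noncomputable def linForm (k : ℕ) (tab : ℕ → ℕ → ℝ) (a : ℕ → ℝ) (r : ℕ) : ℝ :=
  ∑ c ∈ Finset.range (k + 1), a c * tab c r

/-- The first `n` linear forms are nonnegative at `a`. -/
def LinFeasible (k n : ℕ) (tab : ℕ → ℕ → ℝ) (a : ℕ → ℝ) : Prop :=
  ∀ v < n, 0 ≤ linForm k tab a v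

open Classical in
/-- The total weight of those among the linear forms `n, …, n + m - 1` that are nonnegative
at `a`. -/
noncomputable def linObjective (k n m : ℕ) (w : ℕ → ℕ) (tab : ℕ → ℕ → ℝ) (a : ℕ → ℝ) : ℕ :=
  ∑ j ∈ Finset.range m, if 0 ≤ linForm k tab a (n + j) then w j else 0

/-- The matrix of the linear system that consists of the rows `σ 0, …, σ k` of the table. -/
def systemMatrix (k : ℕ) (tab : ℕ → ℕ → ℝ) (σ : ℕ → ℕ) : Matrix (Fin (k + 1)) (Fin (k + 1)) ℝ :=
  Matrix.of fun i c => tab c (σ i)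

/-- The solution by Cramer's rule of the linear system that consists of the rows `σ 0, …, σ k` of
the table, with right-hand sides in column `k + 1`. -/
noncomputable def basicSolution (k : ℕ) (tab : ℕ → ℕ → ℝ) (σ : ℕ → ℕ) (c : ℕ) : ℝ :=
  if h : c < k + 1 then
    ((systemMatrix k tab σ).updateCol ⟨c, h⟩ fun i => tab (k + 1) (σ i)).det /
      (systemMatrix k tab σ).det
  else 0

/-- Column `k + 1` of the table holds the right-hand sides `0` for the first `n` rows, `-1` for the
next `m` rows and `0` for the last `k + 1` rows, and the latter are the unit vectors. -/
structure IsTable (k n m : ℕ) (tab : ℕ → ℕ → ℝ) : Prop where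
  rhs_fst : ∀ v < n, tab (k + 1) v = 0
  rhs_snd : ∀ j < m, tab (k + 1) (n + j) = -1
  rhs_unit : ∀ c < k + 1, tab (k + 1) (n + m + c) = 0
  unit : ∀ c < k + 1, ∀ c' < k + 1, tab c (n + m + c') = if c = c' then 1 else 0

variable {k n m : ℕ} {w : ℕ → ℕ} {tab : ℕ → ℕ → ℝ}

theorem linForm_congr {a a' : ℕ → ℝ} (h : ∀ c < k + 1, a c = a' c) :
    linForm k tab a = linForm k tab a' := by
  funext r
  exact Finset.sum_congr rfl fun c hc => by rw [h c (Finset.mem_range.mp hc)]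

theorem basicSolution_congr {σ σ' : ℕ → ℕ} (h : ∀ c < k + 1, σ c = σ' c) :
    basicSolution k tab σ = basicSolution k tab σ' := by
  have (i : Fin (k + 1)) : σ i = σ' i := h i i.2
  funext c
  simp [basicSolution, systemMatrix, this]

theorem linForm_eq_dotProduct (a : ℕ → ℝ) (r : ℕ) :
    linForm k tab a r = (fun c : Fin (k + 1) => tab c r) ⬝ᵥ fun c => a c := by
  simp only [linForm, dotProduct, Finset.sum_range, mul_comm]

theorem exists_scaled_le_neg_one (k n m : ℕ) (tab : ℕ → ℕ → ℝ) (a : ℕ → ℝ) :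
    ∃ l : ℝ, 0 < l ∧ ∀ j < m, linForm k tab a (n + j) < 0 → l * linForm k tab a (n + j) ≤ -1 := by
  -- The sum dominates every reciprocal that is needed; the summand `1` keeps the factor positive
  -- even if the sum vanishes.
  refine ⟨1 + ∑ j ∈ Finset.range m, |linForm k tab a (n + j)|⁻¹, by positivity, ?_⟩
  intro j hj hneg
  have h1 : |linForm k tab a (n + j)|⁻¹ ≤ ∑ j ∈ Finset.range m, |linForm k tab a (n + j)|⁻¹ :=
    Finset.single_le_sum (f := fun j => |linForm k tab a (n + j)|⁻¹)
      (fun i _ => by positivity) (Finset.mem_range.mpr hj)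
  have h2 : |linForm k tab a (n + j)|⁻¹ * linForm k tab a (n + j) = -1 := by
    rw [abs_of_neg hneg, inv_neg, neg_mul, inv_mul_cancel₀ hneg.ne]
  nlinarith

/-- The vertex argument, applied to the polyhedron adapted to `a`: strict negativity is replaced by
the closed condition `≤ -1`, which a positive multiple of `a` satisfies. -/
theorem IsTable.exists_basicSolution (h : IsTable k n m tab) (w : ℕ → ℕ) (a : ℕ → ℝ)
    (ha : LinFeasible k n tab a) :
    ∃ σ : ℕ → ℕ, (∀ c < k + 1, σ c < n + m + (k + 1)) ∧
      LinFeasible k n tab (basicSolution k tab σ) ∧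
      linObjective k n m w tab (basicSolution k tab σ) ≤ linObjective k n m w tab a := by
  classical
  obtain ⟨l, hl, hscale⟩ := exists_scaled_le_neg_one k n m tab a
  -- Among the middle rows, only those negative at `a` impose a constraint.
  let ι := {r : Fin (n + m + (k + 1)) // n ≤ r.1 → r.1 < n + m → linForm k tab a r.1 < 0}
  -- The signs turn all constraints into lower bounds; on the unit rows they are those of the
  -- coordinates of `a`. They cancel from the equations of active constraints, so the table need not
  -- know them.
  let ε : ℕ → ℝ := fun r =>
    if r < n then 1 else if r < n + m then -1 else if 0 ≤ a (r - (n + m)) then 1 else -1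
  have hε : ∀ r, ε r ≠ 0 := fun r => by
    simp only [ε]; split_ifs <;> norm_num
  let row : ℕ → Fin (k + 1) → ℝ := fun r c => tab c r
  let f : ι → Fin (k + 1) → ℝ := fun r => ε r.1.1 • row r.1.1
  have hunit : ∀ (c : Fin (k + 1)) (y : Fin (k + 1) → ℝ), row (n + m + c) ⬝ᵥ y = y c := by
    intro c y
    have : row (n + m + c) = Pi.single c 1 := by
      funext c'
      simp only [row, h.unit c' c'.2 c c.2, Pi.single_apply, Fin.ext_iff]
    simp [this]
  obtain ⟨x, hx, hact⟩ := exists_spanning_active_constraints f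
    (fun r => ε r.1.1 * tab (k + 1) r.1.1)
    (by
      intro y hy
      funext c
      have := hy ⟨⟨n + m + c, by omega⟩, fun _ h => absurd h (by simp)⟩
      simpa [f, hε, smul_dotProduct, hunit] using this)
    (fun c => l * a c)
    (by
      rintro ⟨⟨r, hr⟩, hneg⟩
      have hlin : row r ⬝ᵥ (fun c : Fin (k + 1) => l * a c) = l * linForm k tab a r := by
        rw [linForm_eq_dotProduct, ← smul_eq_mul, ← dotProduct_smul]; rfl
      simp only [f, smul_dotProduct, smul_eq_mul]
      rcases lt_or_ge r n with h1 | h1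
      · simp only [ε, if_pos h1, h.rhs_fst r h1, hlin, one_mul]
        exact mul_nonneg hl.le (ha r h1)
      rcases lt_or_ge r (n + m) with h2 | h2
      · obtain ⟨j, rfl⟩ := Nat.exists_eq_add_of_le h1
        have := hscale j (by omega) (hneg h1 h2)
        simp only [ε, if_neg h1.not_gt, if_pos h2, h.rhs_snd j (by omega), hlin]
        linarith
      · obtain ⟨c, rfl⟩ := Nat.exists_eq_add_of_le h2
        have hc : c < k + 1 := by omega
        rw [h.rhs_unit c hc, hunit ⟨c, hc⟩]
        simp only [ε, if_neg h1.not_gt, if_neg h2.not_gt, Nat.add_sub_cancel_left, mul_zero]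
        split_ifs with h0
        · rw [one_mul]; exact mul_nonneg hl.le h0
        · have := mul_pos hl (neg_pos.mpr (not_le.mp h0))
          linarith)
  obtain ⟨g, hg⟩ := exists_det_ne_zero_of_spanning
    (fun r : {r : ι // f r ⬝ᵥ x = ε r.1.1 * tab (k + 1) r.1.1} => row r.1.1.1)
    (fun y hy => hact y fun r hr => by
      simp only [f, smul_dotProduct, hy ⟨r, hr⟩, smul_zero])
  let σ : ℕ → ℕ := fun c => if h : c < k + 1 then (g ⟨c, h⟩).1.1.1 else 0
  have hσ : ∀ c : Fin (k + 1), σ c = (g c).1.1.1 := fun c => dif_pos c.2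
  have hM : systemMatrix k tab σ = Matrix.of fun c => row (g c).1.1.1 := by
    ext i c; simp [systemMatrix, hσ, row]
  have hsol : ∀ c : Fin (k + 1), basicSolution k tab σ c = x c := by
    intro c
    rw [basicSolution, dif_pos c.2, Matrix.eq_cramer_div_det (M := systemMatrix k tab σ)
      (x := x) (b := fun i => tab (k + 1) (σ i)) (by rw [hM]; exact hg)]
    rw [hM]
    funext i
    have := (g i).2
    simp only [f, smul_dotProduct, smul_eq_mul] at this
    rw [hσ]
    exact mul_left_cancel₀ (hε _) this
  have hlin : ∀ r, linForm k tab (basicSolution k tab σ) r = row r ⬝ᵥ x := by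
    intro r
    rw [linForm_eq_dotProduct]
    simp only [hsol, row]
  refine ⟨σ, fun c hc => ?_, fun v hv => ?_, ?_⟩
  · rw [hσ ⟨c, hc⟩]; exact (g ⟨c, hc⟩).1.1.2
  · have := hx ⟨⟨v, by omega⟩, fun h => absurd h (by simpa using hv)⟩
    simpa [f, ε, hv, h.rhs_fst v hv, hlin] using this
  · refine Finset.sum_le_sum fun j hj => ?_
    have hj := Finset.mem_range.mp hj
    by_cases h0 : 0 ≤ linForm k tab a (n + j)
    · rw [if_pos h0]; split_ifs <;> simp
    · have := hx ⟨⟨n + j, by omega⟩, fun _ _ => not_le.mp h0⟩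
      simp only [f, ε, smul_dotProduct, smul_eq_mul, if_neg (show ¬ n + j < n by omega),
        if_pos (show n + j < n + m by omega), h.rhs_snd j hj, ← hlin] at this
      rw [if_neg (by linarith)]
      exact Nat.zero_le _

end PolyInertia

/-! ### The programs: trying a tuple, searching all tuples, filling the table -/

namespace PolyInertia

open RealRAM

/-- The memory holds the table in the arrays `1, 2, …` of reals, and a feasible vector in array `0`
of reals together with its objective value in cell `0` of array `0` of naturals. -/
structure Represents (k n m : ℕ) (w : ℕ → ℕ) (tab : ℕ → ℕ → ℝ) (s : Store) : Prop where
  num_fst : s.nat 3 0 = n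
  num_snd : s.nat 0 1 = m
  weight : s.nat 1 = w
  table : ∀ c, s.real (c + 1) = tab c
  feasible : LinFeasible k n tab (s.real 0)
  value : linObjective k n m w tab (s.real 0) = s.nat 0 0

theorem expressible_basicSolution (k c : ℕ) :
    Expressible fun s => basicSolution k (fun c => s.real (c + 1)) (s.nat 2) c := by
  have hcell : ∀ (c : ℕ) (i : Fin (k + 1)), Expressible fun s => s.real (c + 1) (s.nat 2 i) :=
    fun c i => Expressible.cell (c + 1) (.cell 2 (.lit i))
  unfold basicSolution
  split_ifs with h
  · refine .div (.det fun i j => ?_) (.det fun i j => hcell j i)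
    simp only [Matrix.updateCol_apply]
    split_ifs
    · exact hcell _ _
    · exact hcell _ _
  · exact .zero

theorem expressible_linForm (k : ℕ) (i : NExp) :
    Expressible fun s => linForm k (fun c => s.real (c + 1))
      (basicSolution k (fun c => s.real (c + 1)) (s.nat 2)) (i.eval s) :=
  .sum _ fun c => (expressible_basicSolution k c).mul (.cell (c + 1) i)

/-- Feasibility is tested by counting the violated rows. For a singular system the division
convention yields the zero vector; this needs no special treatment, since every candidate is tested.
-/
theorem exists_prog_compare_basicSolution (k : ℕ) : ∃ (P : Prog) (C : ℕ),
    ∀ (n m : ℕ) (w : ℕ → ℕ) (tab : ℕ → ℕ → ℝ) (s : Store), Represents k n m w tab s →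
      Runs P s ((n + m + 2) * C) fun s' => Represents k n m w tab s' ∧ s'.nat 2 = s.nat 2 ∧
        s'.nat 0 0 ≤ s.nat 0 0 ∧ (LinFeasible k n tab (basicSolution k tab (s.nat 2)) →
          s'.nat 0 0 ≤ linObjective k n m w tab (basicSolution k tab (s.nat 2))) := by
  classical
  choose F hF using expressible_basicSolution k
  choose E hE using expressible_linForm k
  beta_reduce at hF hE
  let counter : NExp := .cell 4 (.lit 0)
  let num : NExp := .cell 3 (.lit 0)
  let num' : NExp := .cell 0 (.lit 1)
  let violated : Test := .neg (.rle .zero (E counter))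
  let counted : Test := .rle .zero (E (.add num counter))
  let better : Test := .conj (.nle (.cell 5 (.lit 0)) (.lit 0))
    (.nle (.cell 6 (.lit 0)) (.cell 0 (.lit 0)))
  let C₁ := violated.cost + (NExp.lit 1).cost + num.cost + 30
  let C₂ := counted.cost + (NExp.cell 1 counter).cost + num'.cost + 30
  let C₃ := ∑ c ∈ Finset.range (k + 1), ((NExp.lit c).cost + (F c).cost + 1) + 1
  refine ⟨.seq (.sumLoop 4 5 num violated (.lit 1))
    (.seq (.sumLoop 4 6 num' counted (.cell 1 counter))
      (.ite better (.seq (.setNat 0 (.lit 0) (.cell 6 (.lit 0)))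
        (.rep (fun c => .setReal 0 (.lit c) (F c)) (k + 1))) .skip)),
    C₁ + C₂ + (C₃ + better.cost + 10), ?_⟩
  intro n m w tab s hs
  set a := basicSolution k tab (s.nat 2) with ha
  have htab : ∀ s' : Store, s'.real = s.real → (fun c => s'.real (c + 1)) = tab := fun s' h => by
    funext c; rw [h, hs.table]
  have hE' : ∀ (s' : Store) (i : NExp), s'.real = s.real → s'.nat 2 = s.nat 2 →
      (E i).eval s' = linForm k tab a (i.eval s') := fun s' i h1 h2 => by
    rw [hE, htab s' h1, h2]
  refine (Runs.seq (T₁ := (n + 1) * C₁) (T₂ := (m + 1) * C₂ + (better.cost + 1 + (C₃ + 4 + 1)))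
    ((Runs.sumLoop (by norm_num) s (fun v => ¬ 0 ≤ linForm k tab a v) (fun _ => 1)
      (N := n) ?_).mono le_rfl ?_)).mono ?_ fun _ h => h
  · intro s' h1 h2
    refine ⟨?_, fun _ => ⟨?_, rfl⟩⟩
    · simp [num, NExp.eval, h2, hs.num_fst]
    · simp only [violated, Test.Holds, RExp.eval, hE' s' _ h1 (h2 2 (by norm_num) (by norm_num))]
      rfl
  · rintro s₁ ⟨h1, h2, h3⟩
    refine Runs.seq ((Runs.sumLoop (by norm_num) s₁ (fun j => 0 ≤ linForm k tab a (n + j)) w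
      (N := m) ?_).mono le_rfl ?_)
    · intro s' g1 g2
      refine ⟨?_, fun _ => ⟨?_, ?_⟩⟩
      · simp [num', NExp.eval, g2, h2, hs.num_snd]
      · simp only [counted, Test.Holds, RExp.eval, hE' s' _ (g1.trans h1)
          ((g2 2 (by norm_num) (by norm_num)).trans (h2 2 (by norm_num) (by norm_num)))]
        simp [NExp.eval, num, counter, g2, h2, hs.num_fst]
      · simp [NExp.eval, counter, g2, h2, hs.weight]
    · rintro s₂ ⟨g1, g2, g3⟩
      have hreal : s₂.real = s.real := g1.trans h1
      have hnat : ∀ c, c < 4 → s₂.nat c = s.nat c := fun c hc =>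
        (g2 c (by omega) (by omega)).trans (h2 c (by omega) (by omega))
      have hviol : s₂.nat 5 0 ≤ 0 ↔ LinFeasible k n tab a := by
        rw [g2 5 (by norm_num) (by norm_num), h3]
        simp [LinFeasible]
      have hobj : s₂.nat 6 0 = linObjective k n m w tab a := g3
      have hbetter : better.Holds s₂ ↔
          LinFeasible k n tab a ∧ linObjective k n m w tab a ≤ s.nat 0 0 := by
        simp only [better, Test.Holds, NExp.eval, hviol, hobj, hnat 0 (by norm_num)]
      have hs₂ : Represents k n m w tab s₂ :=
        ⟨by rw [hnat 3 (by norm_num), hs.num_fst], by rw [hnat 0 (by norm_num), hs.num_snd],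
          by rw [hnat 1 (by norm_num), hs.weight], fun c => by rw [hreal, hs.table],
          by rw [hreal]; exact hs.feasible, by rw [hreal, hnat 0 (by norm_num)]; exact hs.value⟩
      refine Runs.ite (T₁ := C₃ + 4) (T₂ := 1) (fun hb => ?_) fun hb => Runs.skip ?_
      · obtain ⟨hfeas, hle⟩ := hbetter.mp hb
        -- The expressions `F c` read no cell of array `0` of reals, so overwriting it coordinate by
        -- coordinate does not disturb the later coordinates.
        refine (Runs.seq (Runs.setNat (Runs.rep_setReal (fun _ => 0) (fun c => .lit c) F a (k + 1) _
          ?_ ?_))).mono (by simp only [NExp.cost, C₃]; omega) ?_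
        · intro c _ c' hc' _
          simp only [NExp.eval]; omega
        · intro s' f1 f2 c hc
          rw [hF, f1, Store.setNat_nat_of_ne _ _ _ (by norm_num), hnat 2 (by norm_num), ha]
          congr 1
          funext c j
          rw [f2 (c + 1) j fun _ _ h => absurd h (by omega), Store.setNat_real, hs₂.table]
        · rintro s₃ ⟨f1, f2, f3⟩
          have hform : linForm k tab (s₃.real 0) = linForm k tab a := linForm_congr f3
          have hval : s₃.nat 0 0 = linObjective k n m w tab a := by
            rw [f1, Store.setNat_nat, if_pos ⟨rfl, rfl⟩]; exact hobj
          refine ⟨⟨?_, ?_, ?_, fun c => ?_, ?_, ?_⟩, ?_, ?_, fun _ => hval.le⟩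
          · rw [f1, Store.setNat_nat_of_ne _ _ _ (by norm_num), hs₂.num_fst]
          · rw [f1, Store.setNat_nat, if_neg (by simp [NExp.eval]), hs₂.num_snd]
          · rw [f1, Store.setNat_nat_of_ne _ _ _ (by norm_num), hs₂.weight]
          · funext j
            rw [f2 (c + 1) j fun _ _ h => absurd h (by omega), Store.setNat_real, hs₂.table]
          · unfold LinFeasible; rw [hform]; exact hfeas
          · rw [hval]; unfold linObjective; rw [hform]
          · rw [f1, Store.setNat_nat_of_ne _ _ _ (by norm_num), hnat 2 (by norm_num)]
          · rw [hval]; exact hle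
      · refine ⟨hs₂, hnat 2 (by norm_num), by rw [hnat 0 (by norm_num)], fun hfeas => ?_⟩
        rw [hnat 0 (by norm_num)]
        by_contra hlt
        exact hb (hbetter.mpr ⟨hfeas, by omega⟩)
  · have e : (n + m + 2) * (C₁ + C₂ + (C₃ + better.cost + 10)) =
      (n + 1) * C₁ + (m + 1) * C₂ + (C₃ + better.cost + 10) + ((m + 1) * C₁ + (n + 1) * C₂ +
        (n + m + 1) * (C₃ + better.cost + 10)) := by ring
    omega

theorem exists_prog_minimize (k : ℕ) : ∃ (P : Prog) (C : ℕ),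
    ∀ (n m : ℕ) (w : ℕ → ℕ) (tab : ℕ → ℕ → ℝ) (s : Store), Represents k n m w tab s →
      Runs P s ((n + m + (k + 1) + 1) ^ (k + 1) * ((n + m + 2) * C + (k + 1) * (C + 15)))
        fun s' => Represents k n m w tab s' ∧
        ∀ σ : ℕ → ℕ, (∀ c < k + 1, σ c < n + m + (k + 1)) →
          LinFeasible k n tab (basicSolution k tab σ) →
          s'.nat 0 0 ≤ linObjective k n m w tab (basicSolution k tab σ) := by
  obtain ⟨B, C, hB⟩ := exists_prog_compare_basicSolution k
  let e : NExp := .add (.add (.cell 3 (.lit 0)) (.cell 0 (.lit 1))) (.lit (k + 1))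
  refine ⟨.nest 2 e B (k + 1), C + e.cost, fun n m w tab s hs => ?_⟩
  refine (Runs.nest (N := n + m + (k + 1)) (T := (n + m + 2) * C) (Represents k n m w tab)
    (fun s => s.nat 0 0) (fun σ v => LinFeasible k n tab (basicSolution k tab σ) →
      v ≤ linObjective k n m w tab (basicSolution k tab σ)) (fun σ v v' h g hf => h.trans (g hf))
    ?_ ?_ ?_ (hB n m w tab) (k + 1) s hs).mono ?_ ?_
  · intro s c x h
    have hne : ∀ b, b ≠ 2 → (s.setNat 2 c x).nat b = s.nat b := fun b hb =>
      Store.setNat_nat_of_ne _ _ _ hb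
    exact ⟨by rw [hne 3 (by norm_num), h.num_fst], by rw [hne 0 (by norm_num), h.num_snd],
      by rw [hne 1 (by norm_num), h.weight], h.table, h.feasible,
      by rw [hne 0 (by norm_num)]; exact h.value⟩
  · intro s c x
    simp only [Store.setNat_nat_of_ne _ _ _ (show 0 ≠ 2 by norm_num)]
  · intro s h
    simp [e, NExp.eval, h.num_fst, h.num_snd]
  · gcongr <;> omega
  · rintro s' ⟨h1, _, _, h4⟩
    refine ⟨h1, fun σ hσ => ?_⟩
    -- The nested loops cover only tuples that agree with the memory from `k + 1` on; a basic
    -- solution ignores those entries.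
    rw [basicSolution_congr (σ' := fun j => if j < k + 1 then σ j else s.nat 2 j)
      fun c hc => by simp [hc]]
    exact h4 _ (fun j hj => by simpa [hj] using hσ j hj) fun j hj => by simp [hj.not_gt]

/-- Only the powers of the eigenvalues, the entries `-1` and the ones of the unit rows are written.
The diagonals are already in place, and all zeros of the table come from the initial memory. -/
theorem exists_prog_table (k : ℕ) : ∃ (P : Prog) (C : ℕ), ∀ (n m : ℕ) (s : Store),
    s.nat 0 0 = n → s.nat 0 1 = m → (∀ c < k + 2, ∀ r, n ≤ r → s.real (c + 1) r = 0) →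
      (∀ r, s.real (k + 2) r = 0) →
      Runs P s ((m + 1) * C) fun s' => s'.nat 3 0 = n ∧ s'.nat 0 = s.nat 0 ∧ s'.nat 1 = s.nat 1 ∧
        (∀ c < k + 1, s'.real 0 c = 0) ∧ IsTable k n m (fun c => s'.real (c + 1)) ∧
        (∀ c < k + 1, ∀ v < n, s'.real (c + 1) v = s.real (c + 1) v) ∧
        ∀ c < k + 1, ∀ j < m, s'.real (c + 1) (n + j) = s.real 0 j ^ c := by
  let counter : NExp := .cell 4 (.lit 0)
  let num : NExp := .cell 3 (.lit 0)
  let num' : NExp := .cell 0 (.lit 1)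
  have hentry : ∀ c : ℕ, Expressible fun s =>
      if c < k + 1 then s.real 0 (counter.eval s) ^ c else -1 := by
    intro c
    split_ifs
    · exact (Expressible.cell 0 counter).pow c
    · exact .neg .one
  choose F hF using hentry
  beta_reduce at hF
  let C₁ := ∑ c ∈ Finset.range (k + 2), ((NExp.add num counter).cost + (F c).cost + 1) + 1
  let C₂ := ∑ c ∈ Finset.range (k + 1),
    ((NExp.add (.add num num') (.lit c)).cost + RExp.one.cost + 1) + 1
  let C₃ := ∑ c ∈ Finset.range (k + 1), ((NExp.lit c).cost + RExp.zero.cost + 1) + 1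
  -- The number `n` is copied because its cell will hold the best value. The first `k + 1` cells of
  -- the eigenvalue array are cleared last, as the powers are computed from them.
  refine ⟨.seq (.setNat 3 (.lit 0) (.cell 0 (.lit 0)))
    (.seq (.forLoop 4 0 num' (.rep (fun c => .setReal (c + 1) (.add num counter) (F c)) (k + 2)))
    (.seq (.rep (fun c => .setReal (c + 1) (.add (.add num num') (.lit c)) .one) (k + 1))
      (.rep (fun c => .setReal 0 (.lit c) .zero) (k + 1)))),
    C₁ + num'.cost + 15 + C₂ + C₃ + 4, ?_⟩
  intro n m s hn hm htab hrhs
  refine (Runs.seq (T₂ := (m + 1) * (C₁ + num'.cost + 15) + (C₂ + C₃)) (Runs.setNat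
    (Runs.seq ((Runs.forLoop (N := m) (T := C₁) (fun i s' => s'.nat 3 0 = n ∧
      s'.nat 0 = s.nat 0 ∧ s'.nat 1 = s.nat 1 ∧ s'.nat 4 0 = i ∧ s'.real 0 = s.real 0 ∧
      ∀ c < k + 2, ∀ r, s'.real (c + 1) r = if n ≤ r ∧ r < n + i then
        (if c < k + 1 then s.real 0 (r - n) ^ c else -1) else s.real (c + 1) r)
      ?_ ?_ ?_ ?_).mono le_rfl ?_)))).mono ?_ fun _ h => h
  · simp only [Store.setNat_nat, NExp.eval, Store.setNat_real, hn]
    refine ⟨by simp, ?_, ?_, by simp, trivial, fun c _ r => ?_⟩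
    · funext j; simp [Store.setNat_nat]
    · funext j; simp [Store.setNat_nat]
    · rw [if_neg (by omega)]
  · rintro i s' ⟨_, h2, _⟩
    simp [num', NExp.eval, h2, hm]
  · exact fun i s' h => h.2.2.2.1
  · rintro i hi s₁ ⟨h1, h2, h3, h4, h5, h6⟩
    have hidx : (NExp.add num counter).eval s₁ = n + i := by
      simp [num, counter, NExp.eval, h1, h4]
    refine (Runs.rep_setReal (fun c => c + 1) (fun _ => .add num counter) F
      (fun c => if c < k + 1 then s.real 0 i ^ c else -1) (k + 2) s₁ ?_ ?_).mono le_rfl ?_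
    · intro c _ c' hc' h
      omega
    · intro s' g1 g2 c hc
      rw [hF]
      simp only [counter, NExp.eval, g1, h4, g2 0 i fun c _ h => absurd h (by omega), h5]
    · rintro s₂ ⟨g1, g2, g3⟩
      simp only [Store.setNat_real]
      refine ⟨?_, ?_, ?_, ?_, ?_, fun c hc r => ?_⟩
      · rw [Store.setNat_nat_of_ne _ _ _ (by norm_num), g1, h1]
      · rw [Store.setNat_nat_of_ne _ _ _ (by norm_num), g1, h2]
      · rw [Store.setNat_nat_of_ne _ _ _ (by norm_num), g1, h3]
      · simp [Store.setNat_nat, g1, h4]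
      · funext j
        rw [g2 0 j fun c _ h => absurd h (by omega), h5]
      · by_cases hr : r = n + i
        · subst hr
          have := g3 c hc
          rw [hidx] at this
          rw [this, if_pos (show n ≤ n + i ∧ n + i < n + (i + 1) by omega), Nat.add_sub_cancel_left]
        · rw [g2 (c + 1) r fun _ _ _ => by rw [hidx]; exact fun h => hr h.symm, h6 c hc r]
          by_cases h : n ≤ r ∧ r < n + i
          · rw [if_pos h, if_pos (show n ≤ r ∧ r < n + (i + 1) by omega)]
          · rw [if_neg h, if_neg (show ¬ (n ≤ r ∧ r < n + (i + 1)) by omega)]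
  · rintro s₁ ⟨h1, h2, h3, _, h5, h6⟩
    have hidx : ∀ c, (NExp.add (.add num num') (.lit c)).eval s₁ = n + m + c := fun c => by
      simp [num, num', NExp.eval, h1, h2, hm]
    refine Runs.seq ((Runs.rep_setReal (fun c => c + 1) (fun c => .add (.add num num') (.lit c))
      (fun _ => .one) (fun _ => 1) (k + 1) s₁ ?_ ?_).mono le_rfl ?_)
    · intro c _ c' hc' h
      omega
    · exact fun _ _ _ _ _ => rfl
    rintro s₂ ⟨g1, g2, g3⟩
    simp only [hidx] at g2 g3
    refine (Runs.rep_setReal (fun _ => 0) (fun c => .lit c)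
      (fun _ => .zero) (fun _ => 0) (k + 1) s₂ ?_ ?_).mono le_rfl ?_
    · intro c _ c' hc' _
      simp only [NExp.eval]; omega
    · exact fun _ _ _ _ _ => rfl
    rintro s₃ ⟨f1, f2, f3⟩
    have hs₃ : ∀ c r, s₃.real (c + 1) r = s₂.real (c + 1) r := fun c r =>
      f2 (c + 1) r fun _ _ h => absurd h (by omega)
    have hlow : ∀ c r, r < n + m → s₃.real (c + 1) r = s₁.real (c + 1) r := fun c r hr => by
      rw [hs₃, g2 _ _ fun _ _ _ => by omega]
    refine ⟨by rw [f1, g1, h1], by rw [f1, g1, h2], by rw [f1, g1, h3], f3,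
      ⟨fun v hv => ?_, fun j hj => ?_, fun c hc => ?_, fun c hc c' hc' => ?_⟩,
      fun c hc v hv => ?_, fun c hc j hj => ?_⟩
    · rw [hlow _ _ (by omega), h6 _ (by omega), if_neg (by omega), hrhs]
    · rw [hlow _ _ (by omega), h6 _ (by omega), if_pos (show n ≤ n + j ∧ n + j < n + m by omega),
        if_neg (by omega)]
    · rw [hs₃, g2 _ _ fun _ _ _ => by omega, h6 _ (by omega), if_neg (by omega), hrhs]
    · rw [hs₃]
      split_ifs with hcc
      · rw [← hcc]; exact g3 c hc
      · rw [g2 _ _ fun _ _ _ => by omega, h6 _ (by omega), if_neg (by omega),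
          htab c (by omega) _ (by omega)]
    · rw [hlow _ _ (by omega), h6 _ (by omega), if_neg (by omega)]
    · rw [hlow _ _ (by omega), h6 _ (by omega), if_pos (show n ≤ n + j ∧ n + j < n + m by omega),
        if_pos hc,
        Nat.add_sub_cancel_left]
  · simp only [NExp.cost]
    have : (m + 1) * (C₁ + num'.cost + 15 + C₂ + C₃ + 4) =
      (m + 1) * (C₁ + num'.cost + 15) + (C₂ + C₃ + 4) + m * (C₂ + C₃ + 4) := by ring
    simp only [num', NExp.cost] at this ⊢
    omega

end PolyInertia

/-! ### Polynomials and graph spectra in terms of the table -/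

namespace PolyInertia

open RealRAM

variable {n : ℕ} (G : SimpleGraph (Fin n)) [DecidableRel G.Adj]

theorem card_roots_charpoly_adj : (adj G).charpoly.roots.card = n := by
  have h : (adj G).IsHermitian := by
    rw [Matrix.IsHermitian, Matrix.conjTranspose_eq_transpose_of_trivial]
    exact G.isSymm_adjMatrix
  simp [h.roots_charpoly_eq_eigenvalues]

theorem length_eigenvalueList_le : (eigenvalueList G).length ≤ n := by
  rw [eigenvalueList, Finset.length_sort]
  exact (Multiset.toFinset_card_le _).trans (card_roots_charpoly_adj G).le

theorem sum_eigenvalueList (f : ℝ → ℕ) :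
    ∑ j ∈ Finset.range (eigenvalueList G).length, f ((eigenvalueList G).getD j 0) =
      ∑ θ ∈ eigenvalueSet G, f θ := by
  have h : (eigenvalueList G).toFinset = eigenvalueSet G := Finset.sort_toFinset _ _
  have hnodup : (eigenvalueList G).Nodup := Finset.sort_nodup _ _
  rw [← h, List.sum_toFinset f hnodup, ← Fin.sum_univ_fun_getElem,
    Finset.sum_range]
  exact Finset.sum_congr rfl fun j _ => by rw [List.getD_eq_getElem _ _ j.2]

/-- The polynomial with the coefficients `a 0, …, a k`. -/
noncomputable def polyOf (k : ℕ) (a : ℕ → ℝ) : ℝ[X] :=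
  ∑ c ∈ Finset.range (k + 1), C (a c) * X ^ c

theorem coeff_polyOf {k c : ℕ} (a : ℕ → ℝ) (hc : c ≤ k) : (polyOf k a).coeff c = a c := by
  simp only [polyOf, finsetSum_coeff, coeff_C_mul, coeff_X_pow, mul_ite, mul_one, mul_zero]
  rw [Finset.sum_ite_eq, if_pos (Finset.mem_range.mpr (by omega))]

theorem natDegree_polyOf_le (k : ℕ) (a : ℕ → ℝ) : (polyOf k a).natDegree ≤ k :=
  natDegree_sum_le_of_forall_le _ _ fun _ hc =>
    (natDegree_C_mul_X_pow_le _ _).trans (Nat.lt_succ_iff.mp (Finset.mem_range.mp hc))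

theorem polyOf_coeff {k : ℕ} {p : ℝ[X]} (hp : p.natDegree ≤ k) : polyOf k p.coeff = p :=
  (as_sum_range_C_mul_X_pow' p (Nat.lt_succ_of_le hp)).symm

/-- The table holds the diagonals of the powers of the adjacency matrix, and the powers of its
eigenvalues. -/
structure IsTableOf (k : ℕ) (tab : ℕ → ℕ → ℝ) : Prop
    extends IsTable k n (eigenvalueList G).length tab where
  diag : ∀ c < k + 1, ∀ v : Fin n, tab c v = (adj G ^ c) v v
  eig : ∀ c < k + 1, ∀ j < (eigenvalueList G).length,
    tab c (n + j) = (eigenvalueList G).getD j 0 ^ c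

variable {G} {k : ℕ} {tab : ℕ → ℕ → ℝ}

theorem IsTableOf.feasible_polyOf (h : IsTableOf G k tab) (a : ℕ → ℝ) :
    Feasible G k (polyOf k a) ↔ LinFeasible k n tab a := by
  have hv : ∀ v : Fin n, (aeval (adj G) (polyOf k a)) v v = linForm k tab a v := by
    intro v
    simp only [polyOf, map_sum, map_mul, aeval_C, map_pow, aeval_X, Matrix.sum_apply, linForm]
    refine Finset.sum_congr rfl fun c hc => ?_
    rw [h.diag c (Finset.mem_range.mp hc), ← Algebra.smul_def, Matrix.smul_apply, smul_eq_mul]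
  simp only [Feasible, natDegree_polyOf_le, true_and, hv, LinFeasible]
  exact ⟨fun g v hv => g ⟨v, hv⟩, fun g v => g v v.2⟩

theorem IsTableOf.objective_polyOf (h : IsTableOf G k tab) (a : ℕ → ℝ) :
    objective G (polyOf k a) = linObjective k n (eigenvalueList G).length
      (fun j => ((eigenvalueList G).map (mult G)).getD j 0) tab a := by
  classical
  rw [objective, Finset.sum_filter, ← sum_eigenvalueList, linObjective]
  refine Finset.sum_congr rfl fun j hj => ?_
  have hj := Finset.mem_range.mp hj
  have hform : linForm k tab a (n + j) = (polyOf k a).eval ((eigenvalueList G).getD j 0) := by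
    simp only [polyOf, eval_finsetSum, eval_mul, eval_C, eval_pow, eval_X, linForm]
    exact Finset.sum_congr rfl fun c hc => by rw [h.eig c (Finset.mem_range.mp hc) j hj]
  rw [hform]
  congr 1
  rw [List.getD_eq_getElem _ _ hj, List.getD_eq_getElem _ _ (by simpa using hj), List.getElem_map]

/-- The zero polynomial counts every eigenvalue, and the multiplicities add up to `n` because the
symmetric matrix has only real eigenvalues. This is the number that cell `0` already holds, so the
best value needs no initialisation. -/
theorem IsTableOf.represents_of_zero (h : IsTableOf G k tab) {s : Store} (h₁ : s.nat 3 0 = n)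
    (h₂ : s.nat 0 = (preprocessed G k).nat 0) (h₃ : s.nat 1 = (preprocessed G k).nat 1)
    (htab : ∀ c, s.real (c + 1) = tab c) (h₀ : ∀ c < k + 1, s.real 0 c = 0) :
    Represents k n (eigenvalueList G).length
      (fun j => ((eigenvalueList G).map (mult G)).getD j 0) tab s := by
  have hzero : linForm k tab (s.real 0) = fun _ => 0 := by
    funext r
    exact Finset.sum_eq_zero fun c hc => by rw [h₀ c (Finset.mem_range.mp hc), zero_mul]
  refine ⟨h₁, by rw [h₂]; rfl, h₃, htab, fun v _ => by simp [hzero], ?_⟩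
  have hpoly : polyOf k (s.real 0) = 0 :=
    Finset.sum_eq_zero fun c hc => by rw [h₀ c (Finset.mem_range.mp hc), C_0, zero_mul]
  rw [← h.objective_polyOf, hpoly, h₂]
  simp only [objective, eval_zero, le_refl, Finset.filter_true, mult, eigenvalueSet,
    Multiset.toFinset_sum_count_eq, card_roots_charpoly_adj]
  rfl

theorem IsOptimal.objective_eq_mu {p : ℝ[X]} (hp : IsOptimal G k p) :
    objective G p = mu G k := by
  refine le_antisymm ?_ (Nat.sInf_le ⟨p, hp.1, rfl⟩)
  obtain ⟨q, hq, hq'⟩ := Nat.sInf_mem (s := {c | ∃ p, Feasible G k p ∧ objective G p = c})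
    ⟨_, p, hp.1, rfl⟩
  exact (hp.2 q hq).trans hq'.le

theorem IsTableOf.isOptimal_polyOf (h : IsTableOf G k tab) {s : Store}
    (hs : Represents k n (eigenvalueList G).length
      (fun j => ((eigenvalueList G).map (mult G)).getD j 0) tab s)
    (hmin : ∀ σ : ℕ → ℕ, (∀ c < k + 1, σ c < n + (eigenvalueList G).length + (k + 1)) →
      LinFeasible k n tab (basicSolution k tab σ) →
      s.nat 0 0 ≤ linObjective k n (eigenvalueList G).length
        (fun j => ((eigenvalueList G).map (mult G)).getD j 0) tab (basicSolution k tab σ)) :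
    IsOptimal G k (polyOf k (s.real 0)) := by
  refine ⟨(h.feasible_polyOf _).mpr hs.feasible, fun q hq => ?_⟩
  have hq' := polyOf_coeff hq.1
  rw [← hq'] at hq
  obtain ⟨σ, h1, h2, h3⟩ := h.toIsTable.exists_basicSolution
    (fun j => ((eigenvalueList G).map (mult G)).getD j 0) _ ((h.feasible_polyOf _).mp hq)
  rw [← hq', h.objective_polyOf, h.objective_polyOf, hs.value]
  exact (hmin σ h1 h2).trans h3

end PolyInertia

theorem mainTheorem1 :
    ∀ k : ℕ, ∃ (P : RealRAM.Prog) (T : Polynomial ℕ),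
      ∀ (n : ℕ) (G : SimpleGraph (Fin n)) [DecidableRel G.Adj],
        ∃ (t : ℕ) (s : RealRAM.Store) (p : Polynomial ℝ),
          RealRAM.Exec P (PolyInertia.preprocessed G k) t s ∧
          t ≤ T.eval n ∧
          PolyInertia.IsOptimal G k p ∧
          PolyInertia.objective G p = PolyInertia.mu G k ∧
          s.nat 0 0 = PolyInertia.mu G k ∧
          ∀ i : ℕ, i ≤ k → s.real 0 i = p.coeff i := by
  intro k
  obtain ⟨P₁, C₁, h₁⟩ := PolyInertia.exists_prog_table k
  obtain ⟨P₂, C₂, h₂⟩ := PolyInertia.exists_prog_minimize k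
  -- There are at most `n` distinct eigenvalues, whence `2 * X`; the `k + 2` accounts for the `k +
  -- 1` unit rows and the `+ 1` in the bound for each nested loop.
  refine ⟨.seq P₁ P₂, (X + 1) * C C₁ +
    (2 * X + C (k + 2)) ^ (k + 1) * ((2 * X + 2) * C C₂ + C ((k + 1) * (C₂ + 15))), ?_⟩
  intro n G _
  have hlen := PolyInertia.length_eigenvalueList_le G
  have hdiag : ∀ c < k + 1, ∀ v : Fin n,
      (PolyInertia.preprocessed G k).real (c + 1) v = (PolyInertia.adj G ^ c) v v :=
    fun c hc v => dif_pos ⟨Nat.lt_succ_iff.mp hc, v.2⟩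
  have hrun : RealRAM.Runs (.seq P₁ P₂) (PolyInertia.preprocessed G k) _ _ :=
    .seq ((h₁ n (PolyInertia.eigenvalueList G).length (PolyInertia.preprocessed G k) rfl rfl
      (fun c _ r hr => dif_neg fun h => by omega) fun r => dif_neg fun h => by omega).mono le_rfl
      fun s' ⟨g1, g2, g3, g4, g5, g6, g7⟩ => by
        have htab : PolyInertia.IsTableOf G k fun c => s'.real (c + 1) :=
          { toIsTable := g5
            diag := fun c hc v => (g6 c hc v v.2).trans (hdiag c hc v)
            eig := g7 }
        exact (h₂ n _ _ _ s' (htab.represents_of_zero g1 g2 g3 (fun _ => rfl) g4)).mono le_rfl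
          (R := fun s => ∃ p, PolyInertia.IsOptimal G k p ∧
            PolyInertia.objective G p = s.nat 0 0 ∧ ∀ i ≤ k, s.real 0 i = p.coeff i)
          fun s ⟨f1, f2⟩ => ⟨_, htab.isOptimal_polyOf f1 f2,
            (htab.objective_polyOf _).trans f1.value,
            fun i hi => (PolyInertia.coeff_polyOf _ hi).symm⟩)
  obtain ⟨t, s, he, ht, p, hp, hval, hcoeff⟩ := hrun
  refine ⟨t, s, p, he, ht.trans ?_, hp, hp.objective_eq_mu, hval.symm.trans hp.objective_eq_mu,
    hcoeff⟩
  simp only [eval_add, eval_mul, eval_pow, eval_X, eval_C, eval_one, eval_ofNat]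
  exact Nat.add_le_add (Nat.mul_le_mul_right _ (by omega))
    (Nat.mul_le_mul (Nat.pow_le_pow_left (by omega) _)
      (Nat.add_le_add_right (Nat.mul_le_mul_right _ (by omega)) _))
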